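/- **Setting.** A directed simplicial complex $X$ on a finite vertex set $V$ is a family of non-empty tuples $(x_0,\dots,x_n)$ of elements of $V$ (repetitions allowed) that is closed under deleting an entry from a tuple of length at least two; tuples of length $n+1$ are its $n$-simplices. A filtration of $X$, indexed by a set $T\subseteq\mathbb R$, is a family $(X_\delta)_{\delta\in T}$ of subcomplexes with $X_\delta\subseteq X_{\delta'}$ for $\delta\le\delta'$ and $X=\bigcup_{\delta\in T}X_\delta$. For a semiring $R$ let $C_n(X,R)$ be the free $R$-semimodule on the $n$-simplices, let $\partial^+$ and $\partial^-$ send an $n$-simplex ($n\ge1$) to the sum of its faces obtained by deleting an entry of even, respectively odd, index (both are zero for $n=0$), let $Z_n(X,R)=\{x\in C_n(X,R)\mid\partial^+x=\partial^-x\}$, and let $H_n(X,R)$ be the quotient of $Z_n(X,R)$ by the congruence: $x\sim y$ if and only if $x+\partial^+u+\partial^-v=y+\partial^+v+\partial^-u$ for some $u,v\in C_{n+1}(X,R)$. Let $\Lambda$ be a cancellative semiring whose ring completion (Grothendieck ring) $K(\Lambda)$ is a field. Let $H_n^{\mathrm{Dir}}(X,K(\Lambda))$ be the $K(\Lambda)$-subspace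 of $H_n(X,K(\Lambda))$ generated by the image of the canonical map $H_n(X,\Lambda)\to H_n(X,K(\Lambda))$. For a filtration, the spaces $H_n(X_\delta,K(\Lambda))$ and $H_n^{\mathrm{Dir}}(X_\delta,K(\Lambda))$, $\delta\in T$, with the maps induced by the inclusions, form the undirected and the directed $n$-dimensional persistence module. Compatible bases of a persistence module $(\{V^\delta\},\{\nu_\delta^{\delta'}\})_{\delta\le\delta'\in T}$ over a field are bases $B_\delta$ of the $V^\delta$ such that every $\nu_\delta^{\delta'}$ maps $B_\delta$ into $B_{\delta'}\cup\{0\}$ and no two elements of $B_\delta$ to the same element of $B_{\delta'}$. A bar is a class of basis elements, where each $b\in B_\delta$ is identified with $\nu_\delta^{\delta'}(b)$ whenever the latter is in $B_{\delta'}$; it represents the interval of all times $\delta\in T$ at which it has a representative. The barcode is the family of these bars (the multiset of their intervals). Two bars die at the same time if the same elements of $T$ lie strictly after all times of the one and of the other; a bar is born no later than another if every element of $T$ that lies strictly before all times of the first lies strictly before all times of the second. **Proposition.** Let $(X_\delta)_{\delta\in T}$, $T\subseteq\mathbb R$, be a filtration of a directed simplicial complex $X$ on a finite vertex set, let $\Lambda$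 be a cancellative semiring such that $K(\Lambda)$ is a field, and let $n\ge0$. The directed and the undirected $n$-dimensional persistence modules have compatible bases, hence barcodes $\operatorname{Pers}_n^{\mathrm{Dir}}(X,\Lambda)$ and $\operatorname{Pers}_n(X,\Lambda)$. The inclusions $H_n^{\mathrm{Dir}}(X_\delta,K(\Lambda))\hookrightarrow H_n(X_\delta,K(\Lambda))$ form a monomorphism of persistence modules, and, for any choice of compatible bases, there is an injective map $\sigma$ from the bars of $\operatorname{Pers}_n^{\mathrm{Dir}}(X,\Lambda)$ to the bars of $\operatorname{Pers}_n(X,\Lambda)$ such that every bar $\beta$ and its match $\sigma(\beta)$ die at the same time and $\sigma(\beta)$ is born no later than $\beta$. Moreover $\sigma$ can be taken to be the matching induced by this monomorphism: among the bars with a given death, the $i$-th directed bar in order of birth is matched with the $i$-th undirected bar in order of birth (in any order among bars with equal birth and death). -/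

import Mathlib

universe u v w

noncomputable section

/-! ### The ring completion of a semiring -/

/-- The ring completion `K(Λ)` of a semiring: the Grothendieck group of `(Λ, +)`, whose elements are
the formal differences `[x₁, x₂] = k(x₁) - k(x₂)`. -/
def RingCompletion (Λ : Type v) [Semiring Λ] : Type v :=
  Algebra.GrothendieckAddGroup Λ

namespace RingCompletion

variable {Λ : Type v} [Semiring Λ]

instance : AddCommGroup (RingCompletion Λ) :=
  inferInstanceAs (AddCommGroup (Algebra.GrothendieckAddGroup Λ))

/-- The canonical additive map `k : Λ → K(Λ)`, `x ↦ [x, 0]`. -/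
def ofAdd : Λ →+ RingCompletion Λ :=
  Algebra.GrothendieckAddGroup.of

/-- The biadditive extension of the multiplication of `Λ`. -/
def mulHom : RingCompletion Λ →+ RingCompletion Λ →+ RingCompletion Λ :=
  Algebra.GrothendieckAddGroup.lift (M := Λ) (G := RingCompletion Λ →+ RingCompletion Λ)
    { toFun := fun a =>
        Algebra.GrothendieckAddGroup.lift (M := Λ) (G := RingCompletion Λ)
          (ofAdd.comp (AddMonoidHom.mulLeft a))
      map_zero' := by
        apply Algebra.GrothendieckAddGroup.lift.symm.injective
        rw [Equiv.symm_apply_apply]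
        ext x
        change ofAdd (0 * x) = 0
        rw [zero_mul, map_zero]
      map_add' := fun a b => by
        apply Algebra.GrothendieckAddGroup.lift.symm.injective
        rw [Equiv.symm_apply_apply]
        have h : ∀ c x : Λ, (Algebra.GrothendieckAddGroup.lift (M := Λ) (G := RingCompletion Λ)
            (ofAdd.comp (AddMonoidHom.mulLeft c))) (ofAdd x) = ofAdd (c * x) := fun c x =>
          DFunLike.congr_fun (Algebra.GrothendieckAddGroup.lift.symm_apply_apply
            (ofAdd.comp (AddMonoidHom.mulLeft c))) x
        ext x
        change ofAdd ((a + b) * x) = _ + _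
        rw [add_mul, map_add]
        exact congrArg₂ (· + ·) (h a x).symm (h b x).symm }

instance : Mul (RingCompletion Λ) := ⟨fun x y => mulHom x y⟩

instance : One (RingCompletion Λ) := ⟨ofAdd 1⟩

theorem ofAdd_mul (a b : Λ) : (ofAdd (a * b) : RingCompletion Λ) = ofAdd a * ofAdd b := by
  have h1 : mulHom (ofAdd a) = _ := DFunLike.congr_fun
    (Algebra.GrothendieckAddGroup.lift.symm_apply_apply (_ : Λ →+ _)) a
  change _ = mulHom (ofAdd a) (ofAdd b)
  rw [h1]
  exact (DFunLike.congr_fun (Algebra.GrothendieckAddGroup.lift.symm_apply_apply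
    (ofAdd.comp (AddMonoidHom.mulLeft a))) b).symm

/-- Two additive maps out of `K(Λ)` that agree on `Λ` are equal. -/
theorem hom_ext {G : Type*} [AddCommGroup G] {f g : RingCompletion Λ →+ G}
    (h : ∀ a, f (ofAdd a) = g (ofAdd a)) : f = g :=
  Algebra.GrothendieckAddGroup.lift.symm.injective (AddMonoidHom.ext h)

theorem mul_def' (x y : RingCompletion Λ) : x * y = mulHom x y := rfl

instance : Ring (RingCompletion Λ) :=
  { (inferInstance : AddCommGroup (RingCompletion Λ)),
    (inferInstance : Mul (RingCompletion Λ)),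
    (inferInstance : One (RingCompletion Λ)) with
    left_distrib := fun x y z => map_add (mulHom x) y z
    right_distrib := fun x y z => by simp only [mul_def', map_add, AddMonoidHom.add_apply]
    zero_mul := fun x => by simp only [mul_def', map_zero, AddMonoidHom.zero_apply]
    mul_zero := fun x => map_zero (mulHom x)
    one_mul := fun x => by
      have : mulHom (1 : RingCompletion Λ) = AddMonoidHom.id _ := hom_ext fun a => by
        change ofAdd 1 * ofAdd a = ofAdd a
        rw [← ofAdd_mul, one_mul]
      exact DFunLike.congr_fun this x
    mul_one := fun x => by
      have : mulHom.flip (1 : RingCompletion Λ) = AddMonoidHom.id _ := hom_ext fun a => by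
        change ofAdd a * ofAdd 1 = ofAdd a
        rw [← ofAdd_mul, mul_one]
      exact DFunLike.congr_fun this x
    mul_assoc := fun x y z => by
      have h1 : ∀ a b : Λ, mulHom ((ofAdd a : RingCompletion Λ) * ofAdd b) =
          (mulHom (ofAdd a)).comp (mulHom (ofAdd b)) := fun a b => hom_ext fun c => by
        change ofAdd a * ofAdd b * ofAdd c = ofAdd a * (ofAdd b * ofAdd c)
        simp only [← ofAdd_mul, mul_assoc]
      have h2 : ∀ a : Λ, mulHom.comp (mulHom (ofAdd a : RingCompletion Λ)) =
          (AddMonoidHom.compHom (mulHom (ofAdd a))).comp mulHom := fun a => hom_ext fun b => h1 a b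
      have h3 : (AddMonoidHom.compHom mulHom).comp mulHom =
          ((AddMonoidHom.compHom (M := RingCompletion Λ)).flip mulHom).comp
            ((AddMonoidHom.compHom (M := RingCompletion Λ) (N := RingCompletion Λ)
              (P := RingCompletion Λ)).comp mulHom) := hom_ext fun a => h2 a
      exact DFunLike.congr_fun (DFunLike.congr_fun (DFunLike.congr_fun h3 x) y) z }

/-- The canonical morphism of semirings `k : Λ → K(Λ)`. -/
def of : Λ →+* RingCompletion Λ :=
  { ofAdd with
    map_one' := rfl
    map_mul' := ofAdd_mul }

end RingCompletion

/-! ### Directed simplicial complexes and their homology -/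

/-- A directed simplicial complex (ordered tuple complex) with vertices in `V`: for every `n` a set
of `(n+1)`-tuples of vertices, repetitions allowed, closed under deleting an entry. Its vertex set
consists of the `v` for which the one-element tuple `(v)` is a simplex. -/
@[ext]
structure DirectedComplex (V : Type u) where
  simplices : (n : ℕ) → Set (Fin (n + 1) → V)
  face_mem : ∀ {n : ℕ} {σ : Fin (n + 2) → V}, σ ∈ simplices (n + 1) →
    ∀ i : Fin (n + 2), σ ∘ i.succAbove ∈ simplices n

namespace DirectedComplex

variable {V : Type u}

/-- `X ≤ Y` means that `X` is a subcomplex of `Y`. -/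
instance : LE (DirectedComplex V) := ⟨fun X Y => ∀ n, X.simplices n ⊆ Y.simplices n⟩

/-- The `i`-th face of a simplex. -/
def face (X : DirectedComplex V) {n : ℕ} (σ : X.simplices (n + 1)) (i : Fin (n + 2)) :
    X.simplices n :=
  ⟨σ.1 ∘ i.succAbove, X.face_mem σ.2 i⟩

section Chains

variable (X Y Z : DirectedComplex V) (R : Type v)

/-- The `n`-chains `C_n(X, R)`: the free `R`-semimodule on the `n`-simplices. -/
abbrev Chain [Semiring R] (n : ℕ) : Type (max u v) := X.simplices n →₀ R

variable [Semiring R]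

/-- The positive differential `∂⁺_{n+1}`: the sum of the faces of even index. -/
def boundaryPos (n : ℕ) : X.Chain R (n + 1) →ₗ[R] X.Chain R n :=
  Finsupp.linearCombination R fun σ =>
    ∑ i ∈ Finset.univ.filter (fun i : Fin (n + 2) => Even (i : ℕ)),
      Finsupp.single (X.face σ i) (1 : R)

/-- The negative differential `∂⁻_{n+1}`: the sum of the faces of odd index. -/
def boundaryNeg (n : ℕ) : X.Chain R (n + 1) →ₗ[R] X.Chain R n :=
  Finsupp.linearCombination R fun σ =>
    ∑ i ∈ Finset.univ.filter (fun i : Fin (n + 2) => Odd (i : ℕ)),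
      Finsupp.single (X.face σ i) (1 : R)

/-- The cycles `Z_n(X, R) = {x | ∂⁺x = ∂⁻x}`; both differentials are zero in degree `0`. -/
def cycles : (n : ℕ) → Submodule R (X.Chain R n)
  | 0 => ⊤
  | n + 1 => LinearMap.eqLocus (X.boundaryPos R n) (X.boundaryNeg R n)

/-- The congruence `ρ_n` on the cycles: `x ∼ y` if there are chains `a`, `b` with
`x + ∂⁺a + ∂⁻b = y + ∂⁺b + ∂⁻a`. -/
def homologyCon (n : ℕ) : ModuleCon R (X.cycles R n) where
  r x y := ∃ a b : X.Chain R (n + 1),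
    (x : X.Chain R n) + X.boundaryPos R n a + X.boundaryNeg R n b =
      (y : X.Chain R n) + X.boundaryPos R n b + X.boundaryNeg R n a
  iseqv :=
    { refl := fun x => ⟨0, 0, rfl⟩
      symm := fun {x y} ⟨a, b, h⟩ => ⟨b, a, h.symm⟩
      trans := fun {x y z} ⟨a, b, h⟩ ⟨a', b', h'⟩ => ⟨a + a', b + b', by
        calc (x : X.Chain R n) + X.boundaryPos R n (a + a') + X.boundaryNeg R n (b + b')
            = (x + X.boundaryPos R n a + X.boundaryNeg R n b)
              + (X.boundaryPos R n a' + X.boundaryNeg R n b') := by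
              rw [map_add, map_add]; abel
          _ = (y + X.boundaryPos R n a' + X.boundaryNeg R n b')
              + (X.boundaryPos R n b + X.boundaryNeg R n a) := by rw [h]; abel
          _ = _ := by rw [h', map_add, map_add]; abel⟩ }
  add' := fun {x y x' y'} ⟨a, b, h⟩ ⟨a', b', h'⟩ => ⟨a + a', b + b', by
    calc ((x + x' : X.cycles R n) : X.Chain R n) + X.boundaryPos R n (a + a')
          + X.boundaryNeg R n (b + b')
        = (x + X.boundaryPos R n a + X.boundaryNeg R n b)
          + (x' + X.boundaryPos R n a' + X.boundaryNeg R n b') := by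
          rw [map_add, map_add, Submodule.coe_add]; abel
      _ = _ := by rw [h, h', map_add, map_add, Submodule.coe_add]; abel⟩
  smul := fun c {x y} ⟨a, b, h⟩ => ⟨c • a, c • b, by
    simpa only [map_smul, Submodule.coe_smul, smul_add] using congrArg (c • ·) h⟩

/-- The homology semimodule `H_n(X, R) = Z_n(X, R) / ρ_n`. -/
def Homology (n : ℕ) : Type (max u v) := (X.homologyCon R n).Quotient

instance (n : ℕ) : AddCommMonoid (X.Homology R n) :=
  inferInstanceAs (AddCommMonoid (X.homologyCon R n).Quotient)

instance (n : ℕ) : Module R (X.Homology R n) :=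
  inferInstanceAs (Module R (X.homologyCon R n).Quotient)

/-- The homology class of a cycle. -/
def homologyClass (n : ℕ) : X.cycles R n →ₗ[R] X.Homology R n where
  toFun x := (X.homologyCon R n).toAddCon.mk' x
  map_add' _ _ := rfl
  map_smul' _ _ := rfl

end Chains

/-- Over a ring the homology semimodule is an abelian group. -/
instance (X : DirectedComplex V) (S : Type v) [Ring S] (n : ℕ) : AddCommGroup (X.Homology S n) :=
  Module.addCommMonoidToAddCommGroup S

section Functoriality

variable {X Y Z : DirectedComplex V} {R : Type v} [Semiring R]

theorem homologyClass_surjective (n : ℕ) : Function.Surjective (X.homologyClass R n) :=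
  Quotient.mk_surjective

theorem homologyClass_eq_iff {n : ℕ} {x y : X.cycles R n} :
    X.homologyClass R n x = X.homologyClass R n y ↔ (X.homologyCon R n).r x y :=
  (X.homologyCon R n).toAddCon.eq

/-- The map `C_n(i)` induced by the inclusion `i : X → Y` of a subcomplex. -/
def chainMap (R : Type v) [Semiring R] (h : X ≤ Y) (n : ℕ) : X.Chain R n →ₗ[R] Y.Chain R n :=
  Finsupp.lmapDomain R R (Set.inclusion (h n))

theorem chainMap_boundaryPos (h : X ≤ Y) (n : ℕ) (x : X.Chain R (n + 1)) :
    chainMap R h n (X.boundaryPos R n x) = Y.boundaryPos R n (chainMap R h (n + 1) x) := by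
  refine DFunLike.congr_fun (f := (chainMap R h n).comp (X.boundaryPos R n))
    (g := (Y.boundaryPos R n).comp (chainMap R h (n + 1))) ?_ x
  ext σ : 2
  simp only [LinearMap.comp_apply, Finsupp.lsingle_apply, boundaryPos, chainMap,
    Finsupp.lmapDomain_apply, Finsupp.mapDomain_single, Finsupp.linearCombination_single, one_smul]
  simp only [← Finsupp.lmapDomain_apply R R, map_sum]
  simp only [Finsupp.lmapDomain_apply, Finsupp.mapDomain_single]
  rfl

theorem chainMap_boundaryNeg (h : X ≤ Y) (n : ℕ) (x : X.Chain R (n + 1)) :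
    chainMap R h n (X.boundaryNeg R n x) = Y.boundaryNeg R n (chainMap R h (n + 1) x) := by
  refine DFunLike.congr_fun (f := (chainMap R h n).comp (X.boundaryNeg R n))
    (g := (Y.boundaryNeg R n).comp (chainMap R h (n + 1))) ?_ x
  ext σ : 2
  simp only [LinearMap.comp_apply, Finsupp.lsingle_apply, boundaryNeg, chainMap,
    Finsupp.lmapDomain_apply, Finsupp.mapDomain_single, Finsupp.linearCombination_single, one_smul]
  simp only [← Finsupp.lmapDomain_apply R R, map_sum]
  simp only [Finsupp.lmapDomain_apply, Finsupp.mapDomain_single]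
  rfl

theorem chainMap_mem_cycles (h : X ≤ Y) : ∀ (n : ℕ) (x : X.Chain R n), x ∈ X.cycles R n →
    chainMap R h n x ∈ Y.cycles R n
  | 0, _, _ => Submodule.mem_top
  | n + 1, x, hx => by
    change Y.boundaryPos R n _ = Y.boundaryNeg R n _
    rw [← chainMap_boundaryPos, ← chainMap_boundaryNeg]
    exact congrArg _ hx

/-- The map induced on cycles by the inclusion of a subcomplex. -/
def cyclesMap (R : Type v) [Semiring R] (h : X ≤ Y) (n : ℕ) : X.cycles R n →ₗ[R] Y.cycles R n :=
  (chainMap R h n).restrict (chainMap_mem_cycles h n)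

/-- The map `H_n(i)` induced on homology by the inclusion `i : X → Y` of a subcomplex. -/
def homologyMap (R : Type v) [Semiring R] (h : X ≤ Y) (n : ℕ) :
    X.Homology R n →ₗ[R] Y.Homology R n where
  toFun := Quotient.lift (fun x => Y.homologyClass R n (cyclesMap R h n x)) (by
    rintro x y ⟨a, b, hab⟩
    refine homologyClass_eq_iff.2 ⟨chainMap R h _ a, chainMap R h _ b, ?_⟩
    simp only [← chainMap_boundaryPos, ← chainMap_boundaryNeg]
    have := congrArg (chainMap R h n) hab
    simp only [map_add] at this
    exact this)
  map_add' x y := by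
    obtain ⟨x, rfl⟩ := homologyClass_surjective n x
    obtain ⟨y, rfl⟩ := homologyClass_surjective n y
    exact map_add ((Y.homologyClass R n).comp (cyclesMap R h n)) x y
  map_smul' c x := by
    obtain ⟨x, rfl⟩ := homologyClass_surjective n x
    exact map_smul ((Y.homologyClass R n).comp (cyclesMap R h n)) c x

theorem homologyMap_class (h : X ≤ Y) (n : ℕ) (x : X.cycles R n) :
    homologyMap R h n (X.homologyClass R n x) = Y.homologyClass R n (cyclesMap R h n x) := rfl

theorem homologyMap_id (h : X ≤ X) (n : ℕ) (x : X.Homology R n) : homologyMap R h n x = x := by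
  obtain ⟨x, rfl⟩ := homologyClass_surjective n x
  rw [homologyMap_class]
  congr 1
  exact Subtype.ext (Finsupp.mapDomain_id)

theorem homologyMap_comp (h : X ≤ Y) (h' : Y ≤ Z) (h'' : X ≤ Z) (n : ℕ) (x : X.Homology R n) :
    homologyMap R h' n (homologyMap R h n x) = homologyMap R h'' n x := by
  obtain ⟨x, rfl⟩ := homologyClass_surjective n x
  simp only [homologyMap_class]
  congr 1
  exact Subtype.ext (Finsupp.mapDomain_comp (f := Set.inclusion (h n))
    (g := Set.inclusion (h' n))).symm

end Functoriality

/-! ### Directed homology -/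

section Directed

variable (X : DirectedComplex V) (Λ : Type v) [Semiring Λ]

/-- The canonical map `C_n(X, Λ) → C_n(X, K(Λ))`, which applies `k : Λ → K(Λ)` to the coefficients;
under `C_n(X, K(Λ)) ≅ K(C_n(X, Λ))` it is `x ↦ [x, 0]`. -/
def completionChain (n : ℕ) : X.Chain Λ n →+ X.Chain (RingCompletion Λ) n :=
  Finsupp.mapRange.addMonoidHom (RingCompletion.of (Λ := Λ)).toAddMonoidHom

variable {Λ}

theorem completionChain_single (n : ℕ) (σ : X.simplices n) (a : Λ) :
    X.completionChain Λ n (Finsupp.single σ a) = Finsupp.single σ (RingCompletion.of a) :=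
  Finsupp.mapRange_single (hf := map_zero _)

theorem completionChain_boundaryPos (n : ℕ) (x : X.Chain Λ (n + 1)) :
    X.completionChain Λ n (X.boundaryPos Λ n x) =
      X.boundaryPos (RingCompletion Λ) n (X.completionChain Λ (n + 1) x) := by
  refine DFunLike.congr_fun
    (f := (X.completionChain Λ n).comp (X.boundaryPos Λ n).toAddMonoidHom)
    (g := (X.boundaryPos (RingCompletion Λ) n).toAddMonoidHom.comp
      (X.completionChain Λ (n + 1))) ?_ x
  ext σ a : 2
  simp only [AddMonoidHom.comp_apply, LinearMap.toAddMonoidHom_coe, Finsupp.singleAddHom_apply,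
    completionChain_single, boundaryPos, Finsupp.linearCombination_single, Finset.smul_sum, map_sum,
    Finsupp.smul_single, smul_eq_mul, mul_one]

theorem completionChain_boundaryNeg (n : ℕ) (x : X.Chain Λ (n + 1)) :
    X.completionChain Λ n (X.boundaryNeg Λ n x) =
      X.boundaryNeg (RingCompletion Λ) n (X.completionChain Λ (n + 1) x) := by
  refine DFunLike.congr_fun
    (f := (X.completionChain Λ n).comp (X.boundaryNeg Λ n).toAddMonoidHom)
    (g := (X.boundaryNeg (RingCompletion Λ) n).toAddMonoidHom.comp
      (X.completionChain Λ (n + 1))) ?_ x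
  ext σ a : 2
  simp only [AddMonoidHom.comp_apply, LinearMap.toAddMonoidHom_coe, Finsupp.singleAddHom_apply,
    completionChain_single, boundaryNeg, Finsupp.linearCombination_single, Finset.smul_sum, map_sum,
    Finsupp.smul_single, smul_eq_mul, mul_one]

theorem completionChain_mem_cycles : ∀ (n : ℕ) (x : X.Chain Λ n), x ∈ X.cycles Λ n →
    X.completionChain Λ n x ∈ X.cycles (RingCompletion Λ) n
  | 0, _, _ => Submodule.mem_top
  | n + 1, x, hx => by
    change X.boundaryPos _ n _ = X.boundaryNeg _ n _
    rw [← completionChain_boundaryPos, ← completionChain_boundaryNeg]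
    exact congrArg _ hx

variable (Λ)

/-- The map `H_n(k_X) : H_n(X, Λ) → H_n(X, K(Λ))`, which sends the class of `x` to the class of
`[x, 0]`. -/
def completionHomology (n : ℕ) : X.Homology Λ n → X.Homology (RingCompletion Λ) n :=
  Quotient.lift (fun x => X.homologyClass (RingCompletion Λ) n
      ⟨X.completionChain Λ n x.1, X.completionChain_mem_cycles n x.1 x.2⟩) (by
    rintro x y ⟨a, b, hab⟩
    refine homologyClass_eq_iff.2 ⟨X.completionChain Λ _ a, X.completionChain Λ _ b, ?_⟩
    simp only [← completionChain_boundaryPos, ← completionChain_boundaryNeg]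
    have := congrArg (X.completionChain Λ n) hab
    simpa only [map_add] using this)

/-- The directed homology `H_n^Dir(X, K(Λ))`: the `K(Λ)`-submodule of `H_n(X, K(Λ))` generated by
the image of `H_n(k_X)`. -/
def directedHomology (n : ℕ) : Submodule (RingCompletion Λ) (X.Homology (RingCompletion Λ) n) :=
  Submodule.span (RingCompletion Λ) (Set.range (X.completionHomology Λ n))

variable {X Λ} {Y : DirectedComplex V}

theorem homologyMap_completionHomology (h : X ≤ Y) (n : ℕ) (x : X.Homology Λ n) :
    homologyMap (RingCompletion Λ) h n (X.completionHomology Λ n x) =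
      Y.completionHomology Λ n (homologyMap Λ h n x) := by
  obtain ⟨x, rfl⟩ := homologyClass_surjective n x
  change Y.homologyClass _ n _ = Y.homologyClass _ n _
  congr 1
  apply Subtype.ext
  exact Finsupp.mapDomain_mapRange (Set.inclusion (h n)) x.1
    (RingCompletion.of (Λ := Λ)) (map_zero _) (map_add _)

theorem homologyMap_mem_directed (h : X ≤ Y) (n : ℕ) (x : X.Homology (RingCompletion Λ) n)
    (hx : x ∈ X.directedHomology Λ n) :
    homologyMap (RingCompletion Λ) h n x ∈ Y.directedHomology Λ n := by
  have : X.directedHomology Λ n ≤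
      (Y.directedHomology Λ n).comap (homologyMap (RingCompletion Λ) h n) := by
    refine Submodule.span_le.2 ?_
    rintro _ ⟨y, rfl⟩
    refine Submodule.subset_span ⟨homologyMap Λ h n y, ?_⟩
    rw [homologyMap_completionHomology]
  exact this hx

end Directed

end DirectedComplex

/-! ### Persistence modules and their barcodes -/

/-- A persistence `R`-module over an ordered index set `T`. -/
structure PersistenceModule (R : Type v) [Ring R] (T : Type w) [Preorder T] where
  obj : T → Type u
  [addCommGroup : ∀ t, AddCommGroup (obj t)]
  [module : ∀ t, Module R (obj t)]
  map : ∀ {s t : T}, s ≤ t → obj s →ₗ[R] obj t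
  map_self : ∀ (t : T) (x : obj t), map le_rfl x = x
  map_map : ∀ {r s t : T} (h : r ≤ s) (h' : s ≤ t) (x : obj r),
    map h' (map h x) = map (h.trans h') x

namespace PersistenceModule

attribute [instance] addCommGroup module

variable {R : Type v} [Ring R] {T : Type w} [Preorder T]

/-- A morphism of persistence modules. -/
structure Hom (M N : PersistenceModule.{u} R T) where
  app : ∀ t, M.obj t →ₗ[R] N.obj t
  naturality : ∀ {s t : T} (h : s ≤ t) (x : M.obj s), app t (M.map h x) = N.map h (app s x)

/-- Compatible bases of a persistence module: a basis `B_t` of each space such that the structure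
maps send each basis element to a basis element or to zero, and no two elements of `B_s` to the
same element of `B_t`. -/
structure CompatibleBases (M : PersistenceModule.{u} R T) where
  B : ∀ t, Set (M.obj t)
  linearIndependent : ∀ t, LinearIndependent R ((↑) : B t → M.obj t)
  span_eq_top : ∀ t, Submodule.span R (B t) = ⊤
  map_mem : ∀ {s t : T} (h : s ≤ t), ∀ b ∈ B s, M.map h b ∈ B t ∨ M.map h b = 0
  map_inj : ∀ {s t : T} (h : s ≤ t), ∀ b ∈ B s, ∀ b' ∈ B s,
    M.map h b ∈ B t → M.map h b = M.map h b' → b = b'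

namespace CompatibleBases

variable {M : PersistenceModule.{u} R T} (𝓑 : M.CompatibleBases)

/-- The bars of the barcode, counted with multiplicity: basis elements over all times, where an
element is identified with the basis elements to which it is mapped at later times. If `T` is
finite, every bar has exactly one earliest representative `(b, t)`, the one for which `b` is not in
the image of any earlier basis. -/
def Bar : Type (max u w) :=
  Quot fun (p q : Σ t, 𝓑.B t) => ∃ h : p.1 ≤ q.1, M.map h p.2 = q.2

/-- The interval of `T` that a bar represents: all times at which it has a representative. If `T` is
the finite set `δ_0 < ⋯ < δ_m`, this is `[δ_i, δ_{j+1}) ∩ T` (or `[δ_i, ∞) ∩ T`) for the bar born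
at `δ_i` whose last representative is at `δ_j`. -/
def life (β : 𝓑.Bar) : Set T := {t | ∃ b : 𝓑.B t, Quot.mk _ ⟨t, b⟩ = β}

end CompatibleBases

end PersistenceModule

/-- The times before the birth of an interval. -/
def timesBefore {T : Type w} [Preorder T] (I : Set T) : Set T := {t | ∀ s ∈ I, t < s}

/-- The times from the death of an interval on. For a finite set `T` of reals and `I` given by
`[δ_i, δ_{j+1})`, its least element is the death time `δ_{j+1}`, and it is empty if the death time
is `+∞`. -/
def timesAfter {T : Type w} [Preorder T] (I : Set T) : Set T := {t | ∀ s ∈ I, s < t}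

/-- Two intervals die at the same time. -/
def SameDeath {T : Type w} [Preorder T] (I J : Set T) : Prop := timesAfter I = timesAfter J

/-- The interval `I` is born before `J` or at the same time. -/
def BornNoLater {T : Type w} [Preorder T] (I J : Set T) : Prop := timesBefore I ⊆ timesBefore J

/-- The matching of bars that a monomorphism of persistence modules induces: an injective map `σ`
that sends each bar to a bar with the same death, born no later, and that matches, among the bars
with a given death, in order of birth: the earliest-born with the earliest-born, the second with
the second, and so on (in any order among bars with the same birth and death). -/
structure IsInducedMatching {T : Type w} [Preorder T] {α β : Type*} (I : α → Set T)
    (J : β → Set T) (σ : α → β) : Prop where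
  injective : Function.Injective σ
  sameDeath : ∀ a, SameDeath (I a) (J (σ a))
  bornNoLater : ∀ a, BornNoLater (J (σ a)) (I a)
  monotone : ∀ a a', SameDeath (I a) (I a') → ¬ BornNoLater (I a') (I a) →
    BornNoLater (J (σ a)) (J (σ a'))
  initial : ∀ a b, SameDeath (J b) (J (σ a)) → ¬ BornNoLater (J (σ a)) (J b) → b ∈ Set.range σ

/-! ### Filtrations -/

/-- A filtration of a directed simplicial complex `X`, indexed by a set `T` of reals. -/
structure DirectedFiltration {V : Type u} (X : DirectedComplex V) (T : Set ℝ) where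
  complex : T → DirectedComplex V
  mono : ∀ {s t : T}, s ≤ t → complex s ≤ complex t
  union : ∀ n, X.simplices n = ⋃ t, (complex t).simplices n

namespace DirectedFiltration

variable {V : Type u} {X : DirectedComplex V} {T : Set ℝ} (F : DirectedFiltration X T)
  (Λ : Type v) [Semiring Λ] (n : ℕ)

/-- The `n`-dimensional undirected persistence `K(Λ)`-module of a filtration. -/
def undirected : PersistenceModule.{max u v} (RingCompletion Λ) T where
  obj t := (F.complex t).Homology (RingCompletion Λ) n
  map h := DirectedComplex.homologyMap (RingCompletion Λ) (F.mono h) n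
  map_self _ x := DirectedComplex.homologyMap_id _ n x
  map_map _ _ x := DirectedComplex.homologyMap_comp _ _ _ n x

/-- The `n`-dimensional directed persistence `K(Λ)`-module of a filtration. -/
def directed : PersistenceModule.{max u v} (RingCompletion Λ) T where
  obj t := (F.complex t).directedHomology Λ n
  map h := (DirectedComplex.homologyMap (RingCompletion Λ) (F.mono h) n).restrict
    (DirectedComplex.homologyMap_mem_directed (F.mono h) n)
  map_self _ x := Subtype.ext (DirectedComplex.homologyMap_id _ n x.1)
  map_map _ _ x := Subtype.ext (DirectedComplex.homologyMap_comp _ _ _ n x.1)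

/-- The inclusion of the directed into the undirected persistence module. -/
def inclusion : (F.directed Λ n).Hom (F.undirected Λ n) where
  app t := ((F.complex t).directedHomology Λ n).subtype
  naturality _ _ := rfl

end DirectedFiltration

end

/-!
Let `U` be an upper set of times and `t ∉ U`. The basis elements at time `t` whose bars die exactly
at `U` span a space of vectors whose nonzero elements are killed at the times of `U` and at no
earlier time. A monomorphism preserves this property, and modulo the vectors killed before `U` the
vectors killed on `U` are coordinatized by the bars of the target that die at `U`. So at every time
at most as many bars of the source as of the target die at `U`, and since the counts are finite,
pairing the two families off in order of birth pairs each bar of the source with a bar that is born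
no later.

Compatible bases over a finite set of times are found by induction on the total dimension. A nonzero
vector `x` at the first time with a nonzero space spans, with its images, a persistence submodule;
if `φ` is a linear form with value `1` on the last nonzero image of `x`, the vectors whose later
image is killed by `φ` form a complement. The homology of a filtration with finitely many
`n`-simplices changes only finitely often, which reduces the general case to this one.
-/

/-! ### Matching in order of birth -/

section Sorting

variable {A B L : Type*} [LinearOrder L]

theorem exists_equiv_fin_monotone [Finite A] (f : A → L) :
    ∃ e : Fin (Nat.card A) ≃ A, Monotone (f ∘ e) := by
  let e := (Finite.equivFin A).symm
  refine ⟨(Tuple.sort (f ∘ e)).trans e, ?_⟩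
  simpa only [Equiv.coe_trans, ← Function.comp_assoc] using Tuple.monotone_sort (f ∘ e)

theorem lt_ncard_setOf_le_iff {m : ℕ} {f : A → L} {e : Fin m ≃ A} (he : Monotone (f ∘ e))
    (j : Fin m) (c : L) : (j : ℕ) < {a | f a ≤ c}.ncard ↔ f (e j) ≤ c := by
  have hcard : {a | f a ≤ c}.ncard = Fintype.card {i // (f ∘ e) i ≤ c} := by
    rw [← Nat.card_eq_fintype_card, ← Nat.card_coe_set_eq]
    exact (Nat.card_congr (e.subtypeEquiv fun _ => Iff.rfl)).symm
  rw [hcard, Fintype.card_subtype]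
  exact Tuple.lt_card_le_iff_apply_le_of_monotone he

theorem exists_sorted_matching [Finite A] [Finite B] (f : A → L) (g : B → L)
    (h : ∀ a, {a' | f a' ≤ f a}.ncard ≤ {b | g b ≤ f a}.ncard) :
    ∃ σ : A → B, Function.Injective σ ∧ (∀ a, g (σ a) ≤ f a) ∧
      (∀ a a', f a < f a' → g (σ a) ≤ g (σ a')) ∧ ∀ a b, g b < g (σ a) → b ∈ Set.range σ := by
  obtain ⟨e, he⟩ := exists_equiv_fin_monotone f
  obtain ⟨e', he'⟩ := exists_equiv_fin_monotone g
  have hAB : Nat.card A ≤ Nat.card B := by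
    cases isEmpty_or_nonempty A
    · simp only [Nat.card_of_isEmpty, zero_le]
    · obtain ⟨a, ha⟩ := Finite.exists_max f
      calc Nat.card A = {a' | f a' ≤ f a}.ncard := by
            rw [Set.eq_univ_of_forall (s := {a' | f a' ≤ f a}) ha, Set.ncard_univ]
        _ ≤ {b | g b ≤ f a}.ncard := h a
        _ ≤ Nat.card B := Set.ncard_le_card _
  refine ⟨fun a => e' (Fin.castLE hAB (e.symm a)),
    e'.injective.comp ((Fin.castLE_injective hAB).comp e.symm.injective), fun a => ?_,
    fun a a' haa' => he' ((Fin.castLE_le_castLE_iff _).2 ?_), fun a b hb => ?_⟩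
  · refine (lt_ncard_setOf_le_iff he' _ _).1 (lt_of_lt_of_le ?_ (h a))
    exact (lt_ncard_setOf_le_iff he (e.symm a) (f a)).2 (by rw [e.apply_symm_apply])
  · refine le_of_not_ge fun hle => haa'.not_ge ?_
    simpa only [Function.comp_apply, Equiv.apply_symm_apply] using he hle
  · have hlt : e'.symm b < Fin.castLE hAB (e.symm a) := lt_of_not_ge fun hle =>
      hb.not_ge (by simpa only [Function.comp_apply, Equiv.apply_symm_apply] using he' hle)
    refine ⟨e ⟨e'.symm b, (Fin.lt_def.1 hlt).trans (e.symm a).2⟩, ?_⟩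
    simp only [e.symm_apply_apply, Fin.castLE_mk, Fin.eta, e'.apply_symm_apply]

end Sorting

section Intervals

variable {T : Type w} [LinearOrder T] {I J : Set T} {t : T}

/-- The times before the birth of an interval, as a lower set: in the linear order of lower sets,
births are compared by `BornNoLater`. -/
def birthCut (I : Set T) : LowerSet T :=
  ⟨timesBefore I, fun _ _ hle ht s hs => hle.trans_lt (ht s hs)⟩

theorem notMem_timesBefore (h : t ∈ I) : t ∉ timesBefore I := fun h' => lt_irrefl t (h' t h)

theorem notMem_timesAfter (h : t ∈ I) : t ∉ timesAfter I := fun h' => lt_irrefl t (h' t h)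

theorem isUpperSet_timesAfter (I : Set T) : IsUpperSet (timesAfter I) :=
  fun _ _ hle ht s hs => (ht s hs).trans_le hle

theorem mem_of_notMem_timesBefore_of_notMem_timesAfter (hI : I.OrdConnected)
    (hb : t ∉ timesBefore I) (ha : t ∉ timesAfter I) : t ∈ I := by
  simp only [timesBefore, timesAfter, Set.mem_ofPred_eq, not_forall, not_lt] at hb ha
  obtain ⟨s, hs, hst⟩ := hb
  obtain ⟨u, hu, htu⟩ := ha
  exact hI.out hs hu ⟨hst, htu⟩

theorem BornNoLater.subset (h : BornNoLater J I) (hJ : J.OrdConnected) (hd : SameDeath I J) :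
    I ⊆ J := fun _ ht =>
  mem_of_notMem_timesBefore_of_notMem_timesAfter hJ (fun hb => notMem_timesBefore ht (h hb))
    (hd ▸ notMem_timesAfter ht)

theorem exists_mem_timesBefore_of_not_bornNoLater (h : ¬ BornNoLater J I) :
    ∃ t ∈ I, t ∈ timesBefore J := by
  obtain ⟨u, huJ, huI⟩ := Set.not_subset.1 h
  simp only [timesBefore, Set.mem_ofPred_eq, not_forall, not_lt] at huI
  obtain ⟨t, ht, htu⟩ := huI
  exact ⟨t, ht, (birthCut J).lower htu huJ⟩

end Intervals

section Matching

variable {T : Type w} {α β : Type*} {I : α → Set T} {J : β → Set T}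

theorem exists_isInducedMatching_of_forall_death [Preorder T]
    (h : ∀ U, ∃ σ : {a // timesAfter (I a) = U} → {b // timesAfter (J b) = U},
      IsInducedMatching (fun a => I a.1) (fun b => J b.1) σ) :
    ∃ σ, IsInducedMatching I J σ := by
  choose τ hτ using h
  let σ (a : α) : β := (τ (timesAfter (I a)) ⟨a, rfl⟩).1
  have hσ : ∀ {U} (a : {a // timesAfter (I a) = U}), σ a = τ U a := by
    rintro _ ⟨a, rfl⟩
    rfl
  have hdeath : ∀ a, timesAfter (J (σ a)) = timesAfter (I a) := fun a => (τ _ ⟨a, rfl⟩).2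
  refine ⟨σ, fun a a' e => ?_, fun a => (hdeath a).symm, fun a => (hτ _).bornNoLater ⟨a, rfl⟩,
    fun a a' hd hb => ?_, fun a b hd hb => ?_⟩
  · have ha' : timesAfter (I a') = timesAfter (I a) := by rw [← hdeath, ← e, hdeath]
    exact congrArg Subtype.val ((hτ _).injective (a₁ := ⟨a, rfl⟩) (a₂ := ⟨a', ha'⟩)
      (Subtype.ext (by rw [← hσ, ← hσ, e])))
  · have := (hτ _).monotone ⟨a, rfl⟩ ⟨a', hd.symm⟩ hd hb
    rwa [← hσ, ← hσ] at this
  · obtain ⟨a', ha'⟩ := (hτ _).initial ⟨a, rfl⟩ ⟨b, hd.trans (hdeath a)⟩ hd hb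
    exact ⟨a', by rw [hσ a', ha']⟩

variable [LinearOrder T]

theorem exists_isInducedMatching_of_death_eq [Finite α] [Finite β] {U : Set T}
    (hI : ∀ a, (I a).Nonempty) (hI' : ∀ a, (I a).OrdConnected) (hIU : ∀ a, timesAfter (I a) = U)
    (hJU : ∀ b, timesAfter (J b) = U) (hcount : ∀ t, {a | t ∈ I a}.ncard ≤ {b | t ∈ J b}.ncard) :
    ∃ σ, IsInducedMatching I J σ := by
  have hbirth : ∀ a, {a' | birthCut (I a') ≤ birthCut (I a)}.ncard ≤
      {b | birthCut (J b) ≤ birthCut (I a)}.ncard := fun a => by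
    obtain ⟨t, htI, htJ⟩ : ∃ t ∈ I a, ∀ b, ¬ birthCut (J b) ≤ birthCut (I a) →
        t ∈ timesBefore (J b) := by
      choose t htI htJ using fun b : {b // ¬ birthCut (J b) ≤ birthCut (I a)} =>
        exists_mem_timesBefore_of_not_bornNoLater b.2
      have := (hI a).to_subtype
      obtain ⟨⟨t₀, ht₀⟩, hle⟩ := Finite.exists_ge fun b => (⟨t b, htI b⟩ : I a)
      exact ⟨t₀, ht₀, fun b hb => (birthCut (J b)).lower (hle ⟨b, hb⟩) (htJ ⟨b, hb⟩)⟩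
    calc {a' | birthCut (I a') ≤ birthCut (I a)}.ncard
        ≤ {a' | t ∈ I a'}.ncard := Set.ncard_le_ncard fun a' ha' =>
          BornNoLater.subset ha' (hI' a') ((hIU a).trans (hIU a').symm) htI
      _ ≤ {b | t ∈ J b}.ncard := hcount t
      _ ≤ {b | birthCut (J b) ≤ birthCut (I a)}.ncard := Set.ncard_le_ncard fun b hb =>
          not_not.1 fun hlt => notMem_timesBefore (I := J b) hb (htJ b hlt)
  obtain ⟨σ, hinj, hborn, hmono, hinit⟩ := exists_sorted_matching _ _ hbirth
  exact ⟨σ, hinj, fun a => (hIU a).trans (hJU _).symm, hborn,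
    fun a a' _ hb => hmono a a' (not_le.1 hb), fun a b _ hb => hinit a b (not_le.1 hb)⟩

theorem finite_of_death_eq {U : Set T} (hI : ∀ a, (I a).Nonempty) (hI' : ∀ a, (I a).OrdConnected)
    (hIU : ∀ a, timesAfter (I a) = U) {d : ℕ} (hd : ∀ t, {a | t ∈ I a}.encard ≤ d) :
    Finite α := by
  by_contra hfin
  rw [not_finite_iff_infinite] at hfin
  obtain ⟨s, hs⟩ := Infinite.exists_subset_card_eq α (d + 1)
  obtain ⟨a, -, hmax⟩ := s.exists_max_image (fun a => birthCut (I a))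
    (Finset.card_pos.1 (hs ▸ d.succ_pos))
  obtain ⟨t, ht⟩ := hI a
  have hle : (s : Set α).encard ≤ d := (Set.encard_le_encard fun a' ha' =>
    BornNoLater.subset (hmax a' ha') (hI' a') ((hIU a).trans (hIU a').symm) ht).trans (hd t)
  rw [Set.encard_coe_eq_coe_finsetCard, hs, Nat.cast_le] at hle
  exact d.not_succ_le_self hle

theorem encard_setOf_subtype (p q : α → Prop) :
    {a : {a // p a} | q a}.encard = {a | p a ∧ q a}.encard := by
  rw [← Subtype.val_injective.encard_image]
  congr 1
  ext a
  exact ⟨by rintro ⟨a, ha, rfl⟩; exact ⟨a.2, ha⟩, fun ha => ⟨⟨a, ha.1⟩, ha.2, rfl⟩⟩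

theorem exists_isInducedMatching (hI : ∀ a, (I a).Nonempty) (hI' : ∀ a, (I a).OrdConnected)
    (hJ : ∀ b, (J b).Nonempty) (hJ' : ∀ b, (J b).OrdConnected) {d : ℕ}
    (hd : ∀ t, {b | t ∈ J b}.encard ≤ d)
    (hcount : ∀ U t, {a | timesAfter (I a) = U ∧ t ∈ I a}.encard ≤
      {b | timesAfter (J b) = U ∧ t ∈ J b}.encard) :
    ∃ σ, IsInducedMatching I J σ := by
  refine exists_isInducedMatching_of_forall_death fun U => ?_
  simp only [← encard_setOf_subtype] at hcount
  have hdU : ∀ t, {b : {b // timesAfter (J b) = U} | t ∈ J b}.encard ≤ d := fun t => by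
    rw [encard_setOf_subtype _ fun b => t ∈ J b]
    exact (Set.encard_le_encard fun _ hb => hb.2).trans (hd t)
  have : Finite {b // timesAfter (J b) = U} :=
    finite_of_death_eq (fun b => hJ b.1) (fun b => hJ' b.1) (fun b => b.2) hdU
  have : Finite {a // timesAfter (I a) = U} :=
    finite_of_death_eq (fun a => hI a.1) (fun a => hI' a.1) (fun a => a.2)
      fun t => (hcount U t).trans (hdU t)
  refine exists_isInducedMatching_of_death_eq (fun a => hI a.1) (fun a => hI' a.1) (fun a => a.2)
    (fun b => b.2) fun t => ?_
  rw [← Nat.cast_le (α := ℕ∞), (Set.toFinite _).cast_ncard_eq, (Set.toFinite _).cast_ncard_eq]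
  exact hcount U t

end Matching

/-! ### Bars and coordinates -/

namespace PersistenceModule.CompatibleBases

section Bars

variable {R : Type v} [Ring R] {T : Type w} [LinearOrder T]
  {M : PersistenceModule.{u} R T} (𝓑 : M.CompatibleBases) {s t : T}

/-- The relation that one of two basis elements is the image of the other: the equivalence relation
whose classes are the bars. -/
def Linked (p q : Σ t, 𝓑.B t) : Prop :=
  (∃ h : p.1 ≤ q.1, M.map h p.2 = q.2) ∨ ∃ h : q.1 ≤ p.1, M.map h q.2 = p.2

/-- The bar of a basis element. -/
def barOf (b : 𝓑.B t) : 𝓑.Bar := Quot.mk _ ⟨t, b⟩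

theorem mem_life_barOf (b : 𝓑.B t) : t ∈ 𝓑.life (𝓑.barOf b) := ⟨b, rfl⟩

theorem life_nonempty (β : 𝓑.Bar) : (𝓑.life β).Nonempty := by
  obtain ⟨⟨t, b⟩, rfl⟩ := Quot.exists_rep β
  exact ⟨t, 𝓑.mem_life_barOf b⟩

theorem map_mem_of_ne_zero (h : s ≤ t) {b : M.obj s} (hb : b ∈ 𝓑.B s) (h0 : M.map h b ≠ 0) :
    M.map h b ∈ 𝓑.B t :=
  (𝓑.map_mem h b hb).resolve_right h0

/-- The basis elements at time `t` whose bars have the times of `U` after their death. -/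
def dyingAt (t : T) (U : Set T) : Set (𝓑.B t) :=
  {b | timesAfter (𝓑.life (𝓑.barOf b)) = U}

theorem notMem_of_mem_dyingAt {U : Set T} {b : 𝓑.B t} (hb : b ∈ 𝓑.dyingAt t U) : t ∉ U := by
  rw [← hb]
  exact notMem_timesAfter (𝓑.mem_life_barOf b)

variable [Nontrivial R]

theorem ne_zero_of_mem {b : M.obj t} (hb : b ∈ 𝓑.B t) : b ≠ 0 :=
  (𝓑.linearIndependent t).ne_zero (⟨b, hb⟩ : 𝓑.B t)

theorem map_eq_of_common_image {p q r : Σ t, 𝓑.B t} (hpr : p.1 ≤ r.1) (hpq : p.1 ≤ q.1)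
    (hrq : r.1 ≤ q.1) (hp : M.map hpq p.2 = q.2) (hr : M.map hrq r.2 = q.2) :
    M.map hpr p.2 = r.2 := by
  have hcomp : M.map hrq (M.map hpr p.2.1) = q.2 := by rw [M.map_map, hp]
  have hmem : M.map hpr p.2.1 ∈ 𝓑.B r.1 := 𝓑.map_mem_of_ne_zero hpr p.2.2 fun h0 =>
    𝓑.ne_zero_of_mem q.2.2 (by rw [← hcomp, h0, map_zero])
  exact 𝓑.map_inj hrq _ hmem _ r.2.2 (hcomp ▸ q.2.2) (hcomp.trans hr.symm)

theorem equivalence_linked : Equivalence 𝓑.Linked where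
  refl _ := Or.inl ⟨le_rfl, M.map_self _ _⟩
  symm := Or.symm
  trans {p q r} h h' := by
    rcases h with ⟨h, e⟩ | ⟨h, e⟩ <;> rcases h' with ⟨h', e'⟩ | ⟨h', e'⟩
    · exact Or.inl ⟨h.trans h', by rw [← M.map_map h h', e, e']⟩
    · rcases le_total p.1 r.1 with hpr | hrp
      · exact Or.inl ⟨hpr, 𝓑.map_eq_of_common_image hpr h h' e e'⟩
      · exact Or.inr ⟨hrp, 𝓑.map_eq_of_common_image hrp h' h e' e⟩
    · rcases le_total p.1 r.1 with hpr | hrp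
      · exact Or.inl ⟨hpr, by rw [← e, M.map_map, e']⟩
      · exact Or.inr ⟨hrp, by rw [← e', M.map_map, e]⟩
    · exact Or.inr ⟨h'.trans h, by rw [← M.map_map h' h, e', e]⟩

theorem barOf_eq_barOf_iff (h : s ≤ t) {b : 𝓑.B s} {b' : 𝓑.B t} :
    𝓑.barOf b = 𝓑.barOf b' ↔ M.map h b.1 = b'.1 := by
  refine ⟨fun e => ?_, fun e => Quot.sound ⟨h, e⟩⟩
  have hlinked : 𝓑.Linked ⟨s, b⟩ ⟨t, b'⟩ :=
    𝓑.equivalence_linked.eqvGen_iff.1 ((Quot.eqvGen_exact e).mono fun _ _ => Or.inl)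
  rcases hlinked with ⟨_, e⟩ | ⟨h', e⟩
  · exact e
  · obtain rfl : s = t := le_antisymm h h'
    rw [M.map_self] at e ⊢
    exact e.symm

theorem barOf_injective : Function.Injective (𝓑.barOf (t := t)) := fun b b' h =>
  Subtype.ext (by rw [← (𝓑.barOf_eq_barOf_iff le_rfl).1 h, M.map_self])

theorem mem_life_barOf_iff (h : s ≤ t) (b : 𝓑.B s) :
    t ∈ 𝓑.life (𝓑.barOf b) ↔ M.map h b.1 ≠ 0 := by
  constructor
  · rintro ⟨b', hb'⟩
    rw [(𝓑.barOf_eq_barOf_iff h).1 hb'.symm]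
    exact 𝓑.ne_zero_of_mem b'.2
  · intro h0
    exact ⟨⟨_, 𝓑.map_mem_of_ne_zero h b.2 h0⟩, ((𝓑.barOf_eq_barOf_iff h).2 rfl).symm⟩

theorem ordConnected_life (β : 𝓑.Bar) : (𝓑.life β).OrdConnected := by
  refine ⟨fun s hs u hu t ht => ?_⟩
  obtain ⟨b, rfl⟩ := hs
  refine (𝓑.mem_life_barOf_iff ht.1 b).2 fun h0 => ?_
  refine (𝓑.mem_life_barOf_iff (ht.1.trans ht.2) b).1 hu ?_
  rw [← M.map_map ht.1 ht.2, h0, map_zero]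

theorem mem_timesAfter_barOf_iff (h : s ≤ t) (b : 𝓑.B s) :
    t ∈ timesAfter (𝓑.life (𝓑.barOf b)) ↔ M.map h b.1 = 0 := by
  rw [← not_iff_not, ← ne_eq, ← 𝓑.mem_life_barOf_iff h b]
  refine ⟨fun ht => ?_, notMem_timesAfter⟩
  refine mem_of_notMem_timesBefore_of_notMem_timesAfter (𝓑.ordConnected_life _) (fun hb => ?_) ht
  exact h.not_gt (hb s (𝓑.mem_life_barOf b))

theorem map_eq_zero_iff_of_mem_dyingAt {U : Set T} {b : 𝓑.B s} (hb : b ∈ 𝓑.dyingAt s U)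
    (h : s ≤ t) : M.map h b.1 = 0 ↔ t ∈ U := by
  rw [← 𝓑.mem_timesAfter_barOf_iff h, hb]

theorem mem_dyingAt_of_forall_map_eq_zero_iff {U : Set T} {b : 𝓑.B t} (hU : IsUpperSet U)
    (hb : ∀ (u : T) (h : t ≤ u), M.map h b.1 = 0 ↔ u ∈ U) : b ∈ 𝓑.dyingAt t U := by
  ext u
  rcases le_total t u with h | h
  · rw [𝓑.mem_timesAfter_barOf_iff h, hb u h]
  · refine iff_of_false (fun hu => h.not_gt (hu t (𝓑.mem_life_barOf b))) fun hu => ?_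
    exact 𝓑.ne_zero_of_mem b.2 ((M.map_self t b).symm.trans ((hb t le_rfl).2 (hU h hu)))

theorem encard_bars_dying (t : T) (U : Set T) :
    {β | timesAfter (𝓑.life β) = U ∧ t ∈ 𝓑.life β}.encard = (𝓑.dyingAt t U).encard := by
  rw [← 𝓑.barOf_injective.encard_image]
  congr 1
  ext β
  exact ⟨by rintro ⟨hβ, b, rfl⟩; exact ⟨b, hβ, rfl⟩,
    by rintro ⟨b, hb, rfl⟩; exact ⟨hb, 𝓑.mem_life_barOf b⟩⟩

theorem encard_bars_alive (t : T) : {β | t ∈ 𝓑.life β}.encard = (𝓑.B t).encard := by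
  have hrange : {β | t ∈ 𝓑.life β} = Set.range (𝓑.barOf (t := t)) := rfl
  rw [hrange, ← Set.image_univ, 𝓑.barOf_injective.encard_image, Set.encard_univ, Set.encard]

end Bars

section Coordinates

variable {R : Type v} [Ring R] {T : Type w} [LinearOrder T]
  {M : PersistenceModule.{u} R T} (𝓑 : M.CompatibleBases) {s t : T} {U : Set T}

/-- The set `B_t`, bundled as a basis of the space at time `t`. -/
noncomputable def basis (t : T) : Module.Basis (𝓑.B t) R (M.obj t) :=
  Module.Basis.mk (𝓑.linearIndependent t) (by rw [Subtype.range_coe, 𝓑.span_eq_top])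

theorem basis_apply (t : T) (b : 𝓑.B t) : 𝓑.basis t b = b := by
  rw [basis, Module.Basis.mk_apply]

theorem repr_coe (b : 𝓑.B t) : (𝓑.basis t).repr b = Finsupp.single b 1 := by
  rw [← (𝓑.basis t).repr_self, basis_apply]

theorem repr_map_apply (h : s ≤ t) (b : 𝓑.B s) (hb : M.map h b.1 ∈ 𝓑.B t) (x : M.obj s) :
    (𝓑.basis t).repr (M.map h x) ⟨_, hb⟩ = (𝓑.basis s).repr x b := by
  suffices e : Finsupp.lapply ⟨M.map h b.1, hb⟩ ∘ₗ (𝓑.basis t).repr.toLinearMap ∘ₗ M.map h =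
      Finsupp.lapply b ∘ₗ (𝓑.basis s).repr.toLinearMap from DFunLike.congr_fun e x
  refine (𝓑.basis s).ext fun b' => ?_
  simp only [LinearMap.comp_apply, LinearEquiv.coe_coe, Finsupp.lapply_apply, basis_apply,
    repr_coe]
  rcases eq_or_ne b' b with rfl | hne
  · rw [𝓑.repr_coe ⟨_, hb⟩, Finsupp.single_eq_same, Finsupp.single_eq_same]
  rw [Finsupp.single_eq_of_ne' hne]
  rcases 𝓑.map_mem h b'.1 b'.2 with hb' | hb'
  · rw [𝓑.repr_coe ⟨_, hb'⟩, Finsupp.single_eq_of_ne']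
    exact fun e => hne (Subtype.ext (𝓑.map_inj h _ b'.2 _ b.2 hb' (congrArg Subtype.val e)))
  · rw [hb', map_zero, Finsupp.zero_apply]

theorem repr_eq_zero_of_map_eq_zero (h : s ≤ t) {b : 𝓑.B s} (hb : M.map h b.1 ≠ 0) {x : M.obj s}
    (hx : M.map h x = 0) : (𝓑.basis s).repr x b = 0 := by
  rw [← 𝓑.repr_map_apply h b (𝓑.map_mem_of_ne_zero h b.2 hb), hx, map_zero, Finsupp.zero_apply]

variable [Nontrivial R]

theorem map_eq_zero_of_mem_span_dyingAt (h : s ≤ t) (ht : t ∈ U) {x : M.obj s}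
    (hx : x ∈ Submodule.span R (𝓑.basis s '' 𝓑.dyingAt s U)) : M.map h x = 0 := by
  suffices hle : Submodule.span R (𝓑.basis s '' 𝓑.dyingAt s U) ≤ LinearMap.ker (M.map h) from hle hx
  refine Submodule.span_le.2 ?_
  rintro _ ⟨b, hb, rfl⟩
  rw [basis_apply]
  exact (𝓑.map_eq_zero_iff_of_mem_dyingAt hb h).2 ht

theorem eq_zero_of_mem_span_dyingAt_of_map_eq_zero (h : s ≤ t) (ht : t ∉ U) {x : M.obj s}
    (hx : x ∈ Submodule.span R (𝓑.basis s '' 𝓑.dyingAt s U)) (h0 : M.map h x = 0) : x = 0 := by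
  rw [Module.Basis.mem_span_image] at hx
  refine (𝓑.basis s).repr.map_eq_zero_iff.1 (Finsupp.ext fun b => not_not.1 fun hb => hb ?_)
  have hbU : b ∈ 𝓑.dyingAt s U := hx (Finsupp.mem_support_iff.2 hb)
  exact 𝓑.repr_eq_zero_of_map_eq_zero h
    (fun hb0 => ht ((𝓑.map_eq_zero_iff_of_mem_dyingAt hbU h).1 hb0)) h0

theorem exists_map_eq_zero_of_forall_repr_eq_zero (hU : IsUpperSet U) (hs : s ∉ U) {x : M.obj s}
    (hx : ∀ (t : T) (h : s ≤ t), t ∈ U → M.map h x = 0)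
    (hrepr : ∀ b ∈ 𝓑.dyingAt s U, (𝓑.basis s).repr x b = 0) :
    ∃ (t : T) (h : s ≤ t), t ∉ U ∧ M.map h x = 0 := by
  let K (t : {t // s ≤ t ∧ t ∉ U}) : Submodule R (M.obj s) := LinearMap.ker (M.map t.2.1)
  have hK : Monotone K := fun t t' (h : t.1 ≤ t'.1) y hy => by
    rw [LinearMap.mem_ker] at hy ⊢
    rw [← M.map_map t.2.1 h, hy, map_zero]
  have : Nonempty {t // s ≤ t ∧ t ∉ U} := ⟨⟨s, le_rfl, hs⟩⟩
  suffices hle : Submodule.span R (𝓑.basis s '' ((𝓑.basis s).repr x).support) ≤ ⨆ t, K t by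
    obtain ⟨t, ht⟩ := (Submodule.mem_iSup_of_directed _ hK.directed_le).1
      (hle ((𝓑.basis s).mem_span_image.2 subset_rfl))
    exact ⟨t.1, t.2.1, t.2.2, ht⟩
  refine Submodule.span_le.2 ?_
  rintro _ ⟨b, hb, rfl⟩
  have hb0 : (𝓑.basis s).repr x b ≠ 0 := Finsupp.mem_support_iff.1 hb
  by_contra hbK
  refine hb0 (hrepr b (𝓑.mem_dyingAt_of_forall_map_eq_zero_iff hU fun t h =>
    ⟨fun h0 => not_not.1 fun ht => hbK ?_, fun ht => not_not.1 fun h0 =>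
      hb0 (𝓑.repr_eq_zero_of_map_eq_zero h h0 (hx t h ht))⟩))
  rw [basis_apply]
  exact Submodule.mem_iSup_of_mem ⟨t, h, ht⟩ h0

end Coordinates

/-! ### The matching induced by a monomorphism -/

section Monomorphism

variable {R : Type v} [DivisionRing R] {T : Type w} [LinearOrder T]
  {M N : PersistenceModule.{u} R T} (𝓑 : M.CompatibleBases) (𝓒 : N.CompatibleBases)

theorem disjoint_span_dyingAt_ker_comp (f : M.Hom N) (hf : ∀ t, Function.Injective (f.app t))
    {t : T} {U : Set T} (hU : IsUpperSet U) (ht : t ∉ U) :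
    Disjoint (Submodule.span R (𝓑.basis t '' 𝓑.dyingAt t U))
      (LinearMap.ker ((Finsupp.lsubtypeDomain (𝓒.dyingAt t U) ∘ₗ (𝓒.basis t).repr.toLinearMap) ∘ₗ
        f.app t)) := by
  refine Submodule.disjoint_def.2 fun x hx hx0 => ?_
  obtain ⟨u, h, huU, h0⟩ := 𝓒.exists_map_eq_zero_of_forall_repr_eq_zero hU ht (x := f.app t x)
    (fun u h hu => by rw [← f.naturality h, 𝓑.map_eq_zero_of_mem_span_dyingAt h hu hx, map_zero])
    fun b hb => DFunLike.congr_fun (LinearMap.mem_ker.1 hx0) ⟨b, hb⟩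
  refine 𝓑.eq_zero_of_mem_span_dyingAt_of_map_eq_zero h huU hx (hf u ?_)
  rw [f.naturality h, h0, map_zero]

theorem encard_dyingAt_le (f : M.Hom N) (hf : ∀ t, Function.Injective (f.app t)) (t : T)
    (U : Set T) : (𝓑.dyingAt t U).encard ≤ (𝓒.dyingAt t U).encard := by
  rcases (𝓑.dyingAt t U).eq_empty_or_nonempty with hempty | ⟨b, hb⟩
  · rw [hempty, Set.encard_empty]
    exact zero_le
  have hU : IsUpperSet U := by
    rw [← hb]
    exact isUpperSet_timesAfter _
  have hli : LinearIndependent R fun b : 𝓑.dyingAt t U => 𝓑.basis t b :=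
    (𝓑.basis t).linearIndependent.comp _ Subtype.val_injective
  have hli' := (hli.map (f := (Finsupp.lsubtypeDomain (𝓒.dyingAt t U) ∘ₗ
    (𝓒.basis t).repr.toLinearMap) ∘ₗ f.app t) (by
      rw [← Set.image_eq_range]
      exact 𝓑.disjoint_span_dyingAt_ker_comp 𝓒 f hf hU
        (𝓑.notMem_of_mem_dyingAt hb))).cardinal_lift_le_rank
  rw [rank_finsupp_self] at hli'
  have hle := OrderHomClass.mono Cardinal.toENat hli'
  rwa [Cardinal.toENat_lift, Cardinal.toENat_lift, Cardinal.toENat_lift] at hle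

theorem exists_isInducedMatching_life (f : M.Hom N) (hf : ∀ t, Function.Injective (f.app t))
    {d : ℕ} (hd : ∀ t, Module.rank R (N.obj t) ≤ d) :
    ∃ σ : 𝓑.Bar → 𝓒.Bar, IsInducedMatching 𝓑.life 𝓒.life σ := by
  refine exists_isInducedMatching 𝓑.life_nonempty 𝓑.ordConnected_life 𝓒.life_nonempty
    𝓒.ordConnected_life (d := d) (fun t => ?_) (fun U t => ?_)
  · rw [𝓒.encard_bars_alive, Set.encard, ENat.card, (𝓒.basis t).mk_eq_rank'']
    exact Cardinal.toENat_le_natCast.2 (hd t)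
  · rw [𝓑.encard_bars_dying, 𝓒.encard_bars_dying]
    exact 𝓑.encard_dyingAt_le 𝓒 f hf t U

end Monomorphism

end PersistenceModule.CompatibleBases

/-! ### Existence of compatible bases -/

theorem monotone_rangeSplitting {α β : Type*} [LinearOrder α] [PartialOrder β] {q : α → β}
    (hq : Monotone q) : Monotone (Set.rangeSplitting q) := fun p p' hp => by
  by_contra hlt
  have h := hq (le_of_not_ge hlt)
  rw [Set.apply_rangeSplitting q, Set.apply_rangeSplitting q] at h
  exact hlt (congrArg _ (le_antisymm hp h)).le

theorem linearIndepOn_id_of_subsingleton {R : Type*} [DivisionRing R] {E : Type*}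
    [AddCommGroup E] [Module R E] {s : Set E} (hs : s.Subsingleton) (h0 : 0 ∉ s) :
    LinearIndepOn R id s :=
  have := hs.coe_sort
  (linearIndependent_subsingleton_index_iff _).2 fun b hb => h0 (hb ▸ b.2)

namespace PersistenceModule

section Constructions

variable {R : Type v} [Ring R] {T : Type w} [Preorder T]

/-- The persistence submodule given by a family of submodules that the structure maps preserve. -/
def restrict (M : PersistenceModule.{u} R T) (C : ∀ t, Submodule R (M.obj t))
    (hC : ∀ {s t : T} (h : s ≤ t), ∀ x ∈ C s, M.map h x ∈ C t) : PersistenceModule.{u} R T where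
  obj t := C t
  map h := (M.map h).restrict (hC h)
  map_self t x := Subtype.ext (M.map_self t x.1)
  map_map h h' x := Subtype.ext (M.map_map h h' x.1)

/-- The inclusion of a persistence submodule. -/
def restrictInclusion (M : PersistenceModule.{u} R T) (C : ∀ t, Submodule R (M.obj t))
    (hC : ∀ {s t : T} (h : s ≤ t), ∀ x ∈ C s, M.map h x ∈ C t) : (M.restrict C hC).Hom M where
  app t := (C t).subtype
  naturality _ _ := rfl

theorem range_restrictInclusion_app {M : PersistenceModule.{u} R T}
    {C : ∀ t, Submodule R (M.obj t)} (hC : ∀ {s t : T} (h : s ≤ t), ∀ x ∈ C s, M.map h x ∈ C t)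
    (t : T) : LinearMap.range ((M.restrictInclusion C hC).app t) = C t :=
  Submodule.range_subtype (C t)

/-- The pullback of a persistence module along a monotone map. -/
def reindex {P : Type*} [Preorder P] (M : PersistenceModule.{u} R T) {r : P → T} (hr : Monotone r) :
    PersistenceModule.{u} R P where
  obj p := M.obj (r p)
  map h := M.map (hr h)
  map_self p x := M.map_self (r p) x
  map_map h h' x := M.map_map (hr h) (hr h') x

namespace CompatibleBases

/-- The transfer of compatible bases along levelwise isomorphisms over a monotone map. -/
def comap {P : Type*} [Preorder P] {M : PersistenceModule.{u} R T}
    {N : PersistenceModule.{u} R P} (𝓑 : N.CompatibleBases) {q : T → P} (hq : Monotone q)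
    (e : ∀ t, M.obj t ≃ₗ[R] N.obj (q t))
    (he : ∀ {s t : T} (h : s ≤ t) (x : M.obj s), e t (M.map h x) = N.map (hq h) (e s x)) :
    M.CompatibleBases where
  B t := e t ⁻¹' 𝓑.B (q t)
  linearIndependent t :=
    ((𝓑.linearIndependent (q t)).comp (Set.restrictPreimage _ (e t))
      (Set.restrictPreimage_injective _ (e t).injective)).of_comp (e t).toLinearMap
  span_eq_top t := by
    rw [← LinearEquiv.image_symm_eq_preimage, ← LinearEquiv.coe_coe, Submodule.span_image,
      𝓑.span_eq_top, Submodule.map_top, LinearEquiv.range]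
  map_mem h b hb := by
    rw [Set.mem_preimage, ← (e _).map_eq_zero_iff, he h]
    exact 𝓑.map_mem (hq h) _ hb
  map_inj h b hb b' hb' hmem heq := by
    refine (e _).injective (𝓑.map_inj (hq h) _ hb _ hb' ?_ ?_)
    · rwa [← he h]
    · rw [← he h, ← he h, heq]

variable {L M N : PersistenceModule.{u} R T} (𝓑 : L.CompatibleBases) (𝓒 : N.CompatibleBases)
  (f : L.Hom M) (g : N.Hom M)

theorem span_image_app (t : T) :
    Submodule.span R (f.app t '' 𝓑.B t) = LinearMap.range (f.app t) := by
  rw [Submodule.span_image, 𝓑.span_eq_top, Submodule.map_top]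

theorem linearIndepOn_image_app_union (hf : ∀ t, Function.Injective (f.app t))
    (hg : ∀ t, Function.Injective (g.app t))
    (hfg : ∀ t, Disjoint (LinearMap.range (f.app t)) (LinearMap.range (g.app t))) (t : T) :
    LinearIndepOn R id (f.app t '' 𝓑.B t ∪ g.app t '' 𝓒.B t) := by
  refine LinearIndepOn.id_union (LinearIndepOn.id_image ?_) (LinearIndepOn.id_image ?_) ?_
  · exact (𝓑.linearIndependent t).map' (f.app t) (LinearMap.ker_eq_bot.2 (hf t))
  · exact (𝓒.linearIndependent t).map' (g.app t) (LinearMap.ker_eq_bot.2 (hg t))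
  · rw [span_image_app, span_image_app]
    exact hfg t

variable {s t : T} (h : s ≤ t)

theorem map_mem_image_app {b : M.obj s} (hb : b ∈ f.app s '' 𝓑.B s) :
    M.map h b ∈ f.app t '' 𝓑.B t ∨ M.map h b = 0 := by
  obtain ⟨b, hb, rfl⟩ := hb
  rw [← f.naturality]
  exact (𝓑.map_mem h b hb).imp (Set.mem_image_of_mem _) fun h0 => by rw [h0, map_zero]

theorem eq_of_map_eq_of_mem_image_app (hf : Function.Injective (f.app t)) {b b' : M.obj s}
    (hb : b ∈ f.app s '' 𝓑.B s) (hb' : b' ∈ f.app s '' 𝓑.B s) (h0 : M.map h b ≠ 0)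
    (heq : M.map h b = M.map h b') : b = b' := by
  obtain ⟨b, hb, rfl⟩ := hb
  obtain ⟨b', hb', rfl⟩ := hb'
  rw [← f.naturality] at h0 heq
  rw [← f.naturality] at heq
  exact congrArg _ (𝓑.map_inj h b hb b' hb'
    ((𝓑.map_mem h b hb).resolve_right fun hb0 => h0 (by rw [hb0, map_zero])) (hf heq))

/-- The compatible bases of a persistence module that is the internal direct sum of two persistence
submodules with compatible bases. -/
def union [Nontrivial R] (hf : ∀ t, Function.Injective (f.app t))
    (hg : ∀ t, Function.Injective (g.app t))
    (hfg : ∀ t, IsCompl (LinearMap.range (f.app t)) (LinearMap.range (g.app t))) :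
    M.CompatibleBases where
  B t := f.app t '' 𝓑.B t ∪ g.app t '' 𝓒.B t
  linearIndependent := 𝓑.linearIndepOn_image_app_union 𝓒 f g hf hg fun t => (hfg t).disjoint
  span_eq_top t := by
    rw [Submodule.span_union, span_image_app, span_image_app, (hfg t).sup_eq_top]
  map_mem h b hb := by
    rcases hb with hb | hb
    · exact (𝓑.map_mem_image_app f h hb).imp_left Or.inl
    · exact (𝓒.map_mem_image_app g h hb).imp_left Or.inr
  map_inj {s t} h b hb b' hb' hmem heq := by
    have h0 : M.map h b ≠ 0 :=
      (𝓑.linearIndepOn_image_app_union 𝓒 f g hf hg (fun t => (hfg t).disjoint) t).ne_zero hmem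
    have map_ne : ∀ c ∈ f.app s '' 𝓑.B s, ∀ d ∈ g.app s '' 𝓒.B s, M.map h c ≠ 0 →
        M.map h c ≠ M.map h d := by
      rintro _ ⟨c, -, rfl⟩ _ ⟨d, -, rfl⟩ hne hcd
      rw [← f.naturality] at hne hcd
      rw [← g.naturality] at hcd
      exact hne (Submodule.disjoint_def.1 (hfg t).disjoint _ ⟨_, rfl⟩ ⟨_, hcd.symm⟩)
    rcases hb with hb | hb <;> rcases hb' with hb' | hb'
    · exact 𝓑.eq_of_map_eq_of_mem_image_app f h (hf t) hb hb' h0 heq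
    · exact absurd heq (map_ne b hb b' hb' h0)
    · exact absurd heq.symm (map_ne b' hb' b hb (heq ▸ h0))
    · exact 𝓒.eq_of_map_eq_of_mem_image_app g h (hg t) hb hb' h0 heq

end CompatibleBases

theorem nonempty_compatibleBases_of_subsingleton (M : PersistenceModule.{u} R T)
    [∀ t, Subsingleton (M.obj t)] : Nonempty M.CompatibleBases :=
  ⟨⟨fun _ => ∅, fun _ => linearIndependent_empty_type, fun _ => Subsingleton.elim _ _,
    fun _ _ h => h.elim, fun _ _ h => h.elim⟩⟩

end Constructions

section Splitting

variable {R : Type v} [Ring R] {T : Type w}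

section Preorder

variable [Preorder T]

/-- The subspace at each time that the image of a vector `x` at time `i` spans; it is zero at the
times that do not come after `i`. -/
def orbit (M : PersistenceModule.{u} R T) {i : T} (x : M.obj i) (t : T) : Submodule R (M.obj t) :=
  Submodule.span R (Set.range fun h : i ≤ t => M.map h x)

/-- The vectors at each time whose image at time `j` is killed by the linear form `φ`; it is
everything at the times that do not come before `j`. -/
def kernelAt (M : PersistenceModule.{u} R T) {j : T} (φ : M.obj j →ₗ[R] R) (t : T) :
    Submodule R (M.obj t) :=
  ⨅ h : t ≤ j, LinearMap.ker (φ ∘ₗ M.map h)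

variable {M : PersistenceModule.{u} R T} {i j s t : T} {x : M.obj i} {φ : M.obj j →ₗ[R] R}

theorem map_mem_orbit (h : s ≤ t) : ∀ y ∈ M.orbit x s, M.map h y ∈ M.orbit x t := by
  suffices hle : M.orbit x s ≤ (M.orbit x t).comap (M.map h) from hle
  refine Submodule.span_le.2 ?_
  rintro _ ⟨his, rfl⟩
  exact Submodule.subset_span ⟨his.trans h, (M.map_map his h x).symm⟩

theorem mem_kernelAt {y : M.obj t} : y ∈ M.kernelAt φ t ↔ ∀ h : t ≤ j, φ (M.map h y) = 0 := by
  simp only [kernelAt, Submodule.mem_iInf, LinearMap.mem_ker, LinearMap.comp_apply]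

theorem map_mem_kernelAt (h : s ≤ t) (y : M.obj s) (hy : y ∈ M.kernelAt φ s) :
    M.map h y ∈ M.kernelAt φ t :=
  mem_kernelAt.2 fun htj => by rw [M.map_map]; exact mem_kernelAt.1 hy _

end Preorder

theorem isCompl_orbit_kernelAt [LinearOrder T] {M : PersistenceModule.{u} R T} {i j : T}
    {x : M.obj i} {φ : M.obj j →ₗ[R] R} (hi : ∀ t < i, Subsingleton (M.obj t))
    (hj : ∀ t (h : i ≤ t), j < t → M.map h x = 0) (hij : i ≤ j) (hφ : φ (M.map hij x) = 1) (t : T) :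
    IsCompl (M.orbit x t) (M.kernelAt φ t) := by
  by_cases hit : i ≤ t
  swap
  · have := hi t (not_le.1 hit)
    exact ⟨disjoint_of_subsingleton, codisjoint_of_subsingleton⟩
  have hspan : M.orbit x t = Submodule.span R {M.map hit x} := by
    have : Nonempty (i ≤ t) := ⟨hit⟩
    exact congrArg _ (Set.range_const (c := M.map hit x))
  rw [hspan]
  rcases le_or_gt t j with htj | hjt
  · have hφt : φ (M.map htj (M.map hit x)) = 1 := by rw [M.map_map, hφ]
    refine ⟨Submodule.disjoint_def.2 fun y hy hy0 => ?_, codisjoint_iff.2 (top_le_iff.1 ?_)⟩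
    · obtain ⟨c, rfl⟩ := Submodule.mem_span_singleton.1 hy
      have hc := mem_kernelAt.1 hy0 htj
      rw [map_smul, map_smul, hφt, smul_eq_mul, mul_one] at hc
      rw [hc, zero_smul]
    · rintro y -
      refine Submodule.mem_sup.2 ⟨φ (M.map htj y) • M.map hit x,
        Submodule.mem_span_singleton.2 ⟨_, rfl⟩,
        y - φ (M.map htj y) • M.map hit x, mem_kernelAt.2 fun _ => ?_, by abel⟩
      rw [map_sub, map_sub, map_smul, map_smul, hφt, smul_eq_mul, mul_one, sub_self]
  · have htop : M.kernelAt φ t = ⊤ := iInf_neg (not_le.2 hjt)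
    rw [hj t hit hjt, htop, Submodule.span_singleton_eq_bot.2 rfl]
    exact isCompl_bot_top

theorem exists_natural_linearEquiv [LinearOrder T] (M : PersistenceModule.{u} R T) {c : T → T}
    (hc : Monotone c) (hl : ∀ t, Function.Bijective (M.map (le_max_left t (c t))))
    (hr : ∀ t, Function.Bijective (M.map (le_max_right t (c t)))) :
    ∃ e : ∀ t, M.obj t ≃ₗ[R] M.obj (c t),
      ∀ {s t : T} (h : s ≤ t) (x : M.obj s), e t (M.map h x) = M.map (hc h) (e s x) := by
  let eₗ (t : T) := LinearEquiv.ofBijective _ (hl t)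
  let eᵣ (t : T) := LinearEquiv.ofBijective _ (hr t)
  have hmax {s t : T} (h : s ≤ t) : max s (c s) ≤ max t (c t) := max_le_max h (hc h)
  have naturalₗ {s t : T} (h : s ≤ t) (x) : eₗ t (M.map h x) = M.map (hmax h) (eₗ s x) := by
    simp only [eₗ, LinearEquiv.ofBijective_apply, M.map_map]
  have naturalᵣ {s t : T} (h : s ≤ t) (y) : eᵣ t (M.map (hc h) y) = M.map (hmax h) (eᵣ s y) := by
    simp only [eᵣ, LinearEquiv.ofBijective_apply, M.map_map]
  refine ⟨fun t => (eₗ t).trans (eᵣ t).symm, fun {s t} h x => ?_⟩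
  rw [LinearEquiv.trans_apply, LinearEquiv.symm_apply_eq, naturalₗ h, naturalᵣ h,
    LinearEquiv.trans_apply, LinearEquiv.apply_symm_apply]

end Splitting

section DivisionRing

variable {R : Type v} [DivisionRing R] {T : Type w}

/-- The nonzero images of a vector, as compatible bases of the submodule that they span. -/
def orbitBases [Preorder T] (M : PersistenceModule.{u} R T) {i : T} (x : M.obj i) :
    (M.restrict (M.orbit x) map_mem_orbit).CompatibleBases where
  B t := (M.orbit x t).subtype ⁻¹' (Set.range (fun h : i ≤ t => M.map h x) \ {0})
  linearIndependent t :=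
    linearIndepOn_id_of_subsingleton
      (((Set.subsingleton_range _).anti Set.sdiff_subset).preimage Subtype.val_injective)
      fun h0 => h0.2 rfl
  span_eq_top t := by
    have hspan : Submodule.span R (Set.range (fun h : i ≤ t => M.map h x) \ {0}) = M.orbit x t :=
      Submodule.span_sdiff_singleton_zero
    have htop := Submodule.span_span_coe_preimage (R := R)
      (s := Set.range (fun h : i ≤ t => M.map h x) \ {0})
    rw [hspan] at htop
    exact htop
  map_mem {s t} h := by
    rintro ⟨_, _⟩ ⟨⟨his, rfl⟩, -⟩
    by_cases h0 : M.map h (M.map his x) = 0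
    · exact Or.inr (Subtype.ext h0)
    · exact Or.inl ⟨⟨his.trans h, (M.map_map his h x).symm⟩, h0⟩
  map_inj h b hb b' hb' _ _ := by
    obtain ⟨⟨_, hb⟩, -⟩ := hb
    obtain ⟨⟨_, hb'⟩, -⟩ := hb'
    exact Subtype.ext (hb.symm.trans hb')

variable [LinearOrder T]

theorem exists_isCompl_orbit_kernelAt [Finite T] (M : PersistenceModule.{u} R T)
    (hM : ∃ t, Nontrivial (M.obj t)) :
    ∃ (i j : T) (x : M.obj i) (φ : M.obj j →ₗ[R] R),
      x ≠ 0 ∧ ∀ t, IsCompl (M.orbit x t) (M.kernelAt φ t) := by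
  obtain ⟨i, hi, hmin⟩ := WellFounded.has_min (wellFounded_lt (α := T))
    {t | Nontrivial (M.obj t)} hM
  obtain ⟨x, hx⟩ := @exists_ne _ hi (0 : M.obj i)
  obtain ⟨j, ⟨hij, hxj⟩, hmax⟩ := WellFounded.has_min (wellFounded_gt (α := T))
    {t | ∃ h : i ≤ t, M.map h x ≠ 0} ⟨i, le_rfl, by rwa [M.map_self]⟩
  obtain ⟨φ, hφ⟩ := LinearMap.exists_leftInverse_of_injective
    (LinearMap.toSpanSingleton R (M.obj j) (M.map hij x)) (LinearMap.ker_toSpanSingleton R hxj)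
  refine ⟨i, j, x, φ, hx, isCompl_orbit_kernelAt
    (fun t ht => not_nontrivial_iff_subsingleton.1 fun h => hmin t h ht)
    (fun t h hjt => not_not.1 fun h0 => hmax t ⟨h, h0⟩ hjt) hij ?_⟩
  simpa only [LinearMap.comp_apply, LinearMap.toSpanSingleton_apply, one_smul, LinearMap.id_apply]
    using DFunLike.congr_fun hφ 1

theorem nonempty_compatibleBases_of_finite [Finite T] (M : PersistenceModule.{u} R T)
    [∀ t, Module.Finite R (M.obj t)] : Nonempty M.CompatibleBases := by
  have := Fintype.ofFinite T
  induction hk : ∑ t, Module.finrank R (M.obj t) using Nat.strong_induction_on generalizing M with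
  | _ k ih =>
  subst hk
  by_cases hM : ∃ t, Nontrivial (M.obj t)
  · obtain ⟨i, j, x, φ, hx, hsplit⟩ := M.exists_isCompl_orbit_kernelAt hM
    have hxker : x ∉ M.kernelAt φ i := fun h => hx <|
      Submodule.disjoint_def.1 (hsplit i).disjoint x
        (Submodule.subset_span ⟨le_rfl, M.map_self i x⟩) h
    have hfin : ∀ t, Module.Finite R ((M.restrict (M.kernelAt φ) map_mem_kernelAt).obj t) :=
      fun t => inferInstanceAs (Module.Finite R (M.kernelAt φ t))
    obtain ⟨𝓒⟩ := ih _ (Finset.sum_lt_sum (fun t _ => Submodule.finrank_le (M.kernelAt φ t))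
      ⟨i, Finset.mem_univ i, Submodule.finrank_lt fun h => hxker (h ▸ Submodule.mem_top)⟩)
      (M.restrict (M.kernelAt φ) map_mem_kernelAt) rfl
    exact ⟨(M.orbitBases x).union 𝓒 (M.restrictInclusion _ map_mem_orbit)
      (M.restrictInclusion _ map_mem_kernelAt) (fun t => Submodule.subtype_injective _)
      (fun t => Submodule.subtype_injective _) fun t => by
        rw [range_restrictInclusion_app, range_restrictInclusion_app]
        exact hsplit t⟩
  · have hM : ∀ t, Subsingleton (M.obj t) := fun t =>
      not_nontrivial_iff_subsingleton.1 fun h => hM ⟨t, h⟩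
    exact M.nonempty_compatibleBases_of_subsingleton

theorem nonempty_compatibleBases_of_finite_range (M : PersistenceModule.{u} R T)
    [∀ t, Module.Finite R (M.obj t)] {P : Type*} [LinearOrder P] {q : T → P} (hq : Monotone q)
    (hfin : (Set.range q).Finite)
    (hiso : ∀ {s t : T} (h : s ≤ t), q s = q t → Function.Bijective (M.map h)) :
    Nonempty M.CompatibleBases := by
  let r := Set.rangeSplitting q
  have hr : Monotone r := monotone_rangeSplitting hq
  have hq' : Monotone (Set.rangeFactorization q) := fun _ _ h => hq h
  let c (t : T) : T := r (Set.rangeFactorization q t)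
  have hqc (t : T) : q (c t) = q t := Set.apply_rangeSplitting q _
  have hqmax (t : T) : q (max t (c t)) = q t := by rw [hq.map_max, hqc, max_self]
  obtain ⟨e, he⟩ := M.exists_natural_linearEquiv (hr.comp hq')
    (fun t => hiso (le_max_left t (c t)) (hqmax t).symm)
    (fun t => hiso (le_max_right t (c t)) ((hqc t).trans (hqmax t).symm))
  have : Finite (Set.range q) := hfin
  have : ∀ p, Module.Finite R ((M.reindex hr).obj p) :=
    fun p => inferInstanceAs (Module.Finite R (M.obj (r p)))
  obtain ⟨𝓑⟩ := (M.reindex hr).nonempty_compatibleBases_of_finite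
  exact ⟨𝓑.comap hq' e he⟩

end DivisionRing

end PersistenceModule

/-! ### Homology of filtered complexes -/

namespace DirectedComplex

section Subcomplex

variable {V : Type u} {X Y : DirectedComplex V} {n : ℕ} {R : Type v} [Semiring R]

theorem chainMap_injective (h : X ≤ Y) (n : ℕ) : Function.Injective (chainMap R h n) :=
  Finsupp.mapDomain_injective (Set.inclusion_injective (h n))

theorem chainMap_surjective (h : X ≤ Y) (hs : Y.simplices n ⊆ X.simplices n) :
    Function.Surjective (chainMap R h n) :=
  Finsupp.mapDomain_surjective fun σ => ⟨⟨σ.1, hs σ.2⟩, rfl⟩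

theorem mem_cycles_of_chainMap_mem (h : X ≤ Y) : ∀ {n : ℕ} {x : X.Chain R n},
    chainMap R h n x ∈ Y.cycles R n → x ∈ X.cycles R n
  | 0, _, _ => Submodule.mem_top
  | n + 1, x, hx => by
    change X.boundaryPos R n x = X.boundaryNeg R n x
    apply chainMap_injective h n
    rw [chainMap_boundaryPos, chainMap_boundaryNeg]
    exact hx

theorem homologyMap_surjective (h : X ≤ Y) (hs : Y.simplices n ⊆ X.simplices n) :
    Function.Surjective (homologyMap R h n) := by
  intro y
  obtain ⟨⟨y, hy⟩, rfl⟩ := homologyClass_surjective n y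
  obtain ⟨x, rfl⟩ := chainMap_surjective h hs y
  exact ⟨X.homologyClass R n ⟨x, mem_cycles_of_chainMap_mem h hy⟩, rfl⟩

theorem homologyMap_injective (h : X ≤ Y) (hs : Y.simplices (n + 1) ⊆ X.simplices (n + 1)) :
    Function.Injective (homologyMap R h n) := by
  intro x y hxy
  obtain ⟨x, rfl⟩ := homologyClass_surjective n x
  obtain ⟨y, rfl⟩ := homologyClass_surjective n y
  rw [homologyMap_class, homologyMap_class, homologyClass_eq_iff] at hxy
  obtain ⟨a, b, hab⟩ := hxy
  obtain ⟨a, rfl⟩ := chainMap_surjective h hs a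
  obtain ⟨b, rfl⟩ := chainMap_surjective h hs b
  refine homologyClass_eq_iff.2 ⟨a, b, chainMap_injective h n ?_⟩
  simp only [map_add, chainMap_boundaryPos, chainMap_boundaryNeg]
  exact hab

theorem directedHomology_le_map_homologyMap {Λ : Type v} [Semiring Λ] (h : X ≤ Y)
    (hs : Y.simplices n ⊆ X.simplices n) :
    Y.directedHomology Λ n ≤
      (X.directedHomology Λ n).map (homologyMap (RingCompletion Λ) h n) := by
  refine Submodule.span_le.2 ?_
  rintro _ ⟨y, rfl⟩
  obtain ⟨x, rfl⟩ := homologyMap_surjective h hs y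
  exact ⟨_, Submodule.subset_span ⟨x, rfl⟩, homologyMap_completionHomology h n x⟩

end Subcomplex

section Finiteness

variable {V : Type u} (X : DirectedComplex V) (n : ℕ)

theorem finite_simplices_succ [Finite (X.simplices n)] : Finite (X.simplices (n + 1)) := by
  refine Finite.of_injective (fun σ => (X.face σ 0, X.face σ (Fin.last _))) fun σ τ h => ?_
  obtain ⟨hfirst, hlast⟩ := Prod.ext_iff.1 h
  refine Subtype.ext (funext fun i => ?_)
  induction i using Fin.cases with
  | zero =>
    have := congrFun (congrArg Subtype.val hlast) 0
    simpa [face] using this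
  | succ i =>
    have := congrFun (congrArg Subtype.val hfirst) i
    simpa [face] using this

theorem finite_homology [Finite (X.simplices n)] (R : Type v) [Ring R] [IsNoetherianRing R] :
    Module.Finite R (X.Homology R n) :=
  Module.Finite.of_surjective (X.homologyClass R n) (homologyClass_surjective n)

theorem rank_homology_le (R : Type v) [Ring R] [StrongRankCondition R] :
    Module.rank R (X.Homology R n) ≤ Cardinal.lift.{v} (Cardinal.mk (X.simplices n)) :=
  calc Module.rank R (X.Homology R n)
    _ ≤ Module.rank R (X.cycles R n) :=
      (X.homologyClass R n).rank_le_of_surjective (homologyClass_surjective n)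
    _ ≤ Module.rank R (X.Chain R n) := Submodule.rank_le _
    _ = Cardinal.lift.{v} (Cardinal.mk (X.simplices n)) := rank_finsupp_self R _

end Finiteness

end DirectedComplex

namespace DirectedFiltration

variable {V : Type u} {X : DirectedComplex V} {T : Set ℝ} (F : DirectedFiltration X T)

theorem complex_le (t : T) : F.complex t ≤ X := fun n => by
  rw [F.union n]
  exact Set.subset_iUnion (fun t => (F.complex t).simplices n) t

theorem finite_simplices_complex {n : ℕ} (hX : (X.simplices n).Finite) (t : T) :
    ((F.complex t).simplices n).Finite :=
  hX.subset (F.complex_le t n)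

variable (n : ℕ)

/-- The number of simplices of dimensions `n` and `n + 1` at a given time; the homology in dimension
`n` changes only when it does. -/
noncomputable def simplexCount (t : T) : ℕ :=
  ((F.complex t).simplices n).ncard + ((F.complex t).simplices (n + 1)).ncard

variable [Finite (X.simplices n)]

theorem monotone_simplexCount : Monotone (F.simplexCount n) := fun _ t h => by
  have := X.finite_simplices_succ n
  exact Nat.add_le_add
    (Set.ncard_le_ncard (F.mono h n) (F.finite_simplices_complex (Set.toFinite _) t))
    (Set.ncard_le_ncard (F.mono h (n + 1)) (F.finite_simplices_complex (Set.toFinite _) t))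

theorem finite_range_simplexCount : (Set.range (F.simplexCount n)).Finite := by
  have := X.finite_simplices_succ n
  refine (Set.finite_Iic ((X.simplices n).ncard + (X.simplices (n + 1)).ncard)).subset ?_
  rintro _ ⟨t, rfl⟩
  exact Nat.add_le_add (Set.ncard_le_ncard (F.complex_le t n) (Set.toFinite _))
    (Set.ncard_le_ncard (F.complex_le t (n + 1)) (Set.toFinite _))

variable {n} {s t : T}

theorem simplices_subset_of_simplexCount_eq (h : s ≤ t)
    (he : F.simplexCount n s = F.simplexCount n t) :
    (F.complex t).simplices n ⊆ (F.complex s).simplices n ∧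
      (F.complex t).simplices (n + 1) ⊆ (F.complex s).simplices (n + 1) := by
  have := X.finite_simplices_succ n
  have hfin := F.finite_simplices_complex (n := n) (Set.toFinite _) t
  have hfin' := F.finite_simplices_complex (n := n + 1) (Set.toFinite _) t
  have hle := Set.ncard_le_ncard (F.mono h n) hfin
  have hle' := Set.ncard_le_ncard (F.mono h (n + 1)) hfin'
  unfold simplexCount at he
  exact ⟨(Set.eq_of_subset_of_ncard_le (F.mono h n) (by lia) hfin).ge,
    (Set.eq_of_subset_of_ncard_le (F.mono h (n + 1)) (by lia) hfin').ge⟩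

variable {Λ : Type v} [Semiring Λ]

theorem bijective_undirected_map (h : s ≤ t)
    (he : F.simplexCount n s = F.simplexCount n t) :
    Function.Bijective ((F.undirected Λ n).map h) :=
  have hs := F.simplices_subset_of_simplexCount_eq h he
  ⟨DirectedComplex.homologyMap_injective (F.mono h) hs.2,
    DirectedComplex.homologyMap_surjective (F.mono h) hs.1⟩

theorem bijective_directed_map (h : s ≤ t)
    (he : F.simplexCount n s = F.simplexCount n t) :
    Function.Bijective ((F.directed Λ n).map h) := by
  have hs := F.simplices_subset_of_simplexCount_eq h he
  refine ⟨fun x y hxy => Subtype.ext ?_, fun y => ?_⟩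
  · exact DirectedComplex.homologyMap_injective (F.mono h) hs.2 (congrArg Subtype.val hxy)
  · obtain ⟨x, hx, hxy⟩ := DirectedComplex.directedHomology_le_map_homologyMap (F.mono h) hs.1 y.2
    exact ⟨⟨x, hx⟩, Subtype.ext hxy⟩

end DirectedFiltration

theorem mainTheorem2_general {V : Type u} {Λ : Type v} [Semiring Λ] [Nontrivial (RingCompletion Λ)]
    (hΛ : ∀ a : RingCompletion Λ, IsUnit a ∨ a = 0) {X : DirectedComplex V} {T : Set ℝ}
    (F : DirectedFiltration X T) (n : ℕ) [Finite (X.simplices n)] :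
    Nonempty (F.directed Λ n).CompatibleBases ∧
    Nonempty (F.undirected Λ n).CompatibleBases ∧
    (∀ t, Function.Injective ((F.inclusion Λ n).app t)) ∧
    ∀ (𝓓 : (F.directed Λ n).CompatibleBases) (𝓤 : (F.undirected Λ n).CompatibleBases),
      ∃ σ : 𝓓.Bar → 𝓤.Bar, IsInducedMatching 𝓓.life 𝓤.life σ := by
  let : DivisionRing (RingCompletion Λ) := DivisionRing.ofIsUnitOrEqZero hΛ
  have hfin (t : T) : Finite ((F.complex t).simplices n) :=
    F.finite_simplices_complex (Set.toFinite _) t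
  have hinj (t : T) : Function.Injective ((F.inclusion Λ n).app t) := Submodule.subtype_injective _
  have hundirected (t : T) : Module.Finite (RingCompletion Λ) ((F.undirected Λ n).obj t) :=
    (F.complex t).finite_homology n (RingCompletion Λ)
  have hdirected (t : T) : Module.Finite (RingCompletion Λ) ((F.directed Λ n).obj t) :=
    Module.Finite.of_injective ((F.inclusion Λ n).app t) (hinj t)
  have hrank (t : T) :
      Module.rank (RingCompletion Λ) ((F.undirected Λ n).obj t) ≤ (X.simplices n).ncard := by
    refine ((F.complex t).rank_homology_le n (RingCompletion Λ)).trans ?_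
    rw [← Cardinal.lift_natCast.{v}, Set.cast_ncard (Set.toFinite _)]
    exact Cardinal.lift_le.2 (Cardinal.mk_le_mk_of_subset (F.complex_le t n))
  exact ⟨PersistenceModule.nonempty_compatibleBases_of_finite_range _
      (F.monotone_simplexCount n) (F.finite_range_simplexCount n) F.bijective_directed_map,
    PersistenceModule.nonempty_compatibleBases_of_finite_range _
      (F.monotone_simplexCount n) (F.finite_range_simplexCount n) F.bijective_undirected_map,
    hinj, fun 𝓓 𝓤 => 𝓓.exists_isInducedMatching_life 𝓤 (F.inclusion Λ n) hinj hrank⟩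

theorem mainTheorem2 {V : Type u} [Finite V] {Λ : Type v} [Semiring Λ] [IsCancelAdd Λ]
    (hΛ : IsField (RingCompletion Λ)) {X : DirectedComplex V} {T : Set ℝ}
    (F : DirectedFiltration X T) (n : ℕ) :
    Nonempty (F.directed Λ n).CompatibleBases ∧
    Nonempty (F.undirected Λ n).CompatibleBases ∧
    (∀ t, Function.Injective ((F.inclusion Λ n).app t)) ∧
    ∀ (𝓓 : (F.directed Λ n).CompatibleBases) (𝓤 : (F.undirected Λ n).CompatibleBases),
      ∃ σ : 𝓓.Bar → 𝓤.Bar, IsInducedMatching 𝓓.life 𝓤.life σ :=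
  have := hΛ.nontrivial
  let := hΛ.toField
  mainTheorem2_general (fun a => (eq_or_ne a 0).symm.imp_left Ne.isUnit) F n
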